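/- Let $k$ be a field and let $A$ be a finitely presented monomial $k$-algebra, that is, a unital $k$-algebra isomorphic to $k\{x_1,\dots,x_d\}/I$, where $d\ge 0$ and $I$ is the two-sided ideal generated by a finite set of monomials (words) in the free noncommuting variables $x_1,\dots,x_d$. Suppose that $A$ is prime: $A\neq 0$, and $IJ\neq 0$ for all nonzero two-sided ideals $I,J$ of $A$. Then (1) $A$ is primitive, meaning that $A$ has both a faithful simple left module and a faithful simple right module, or $A$ satisfies a polynomial identity, meaning that there are $n\in\mathbb{N}$ and a nonzero noncommutative polynomial $p\in k\{x_1,\dots,x_n\}$ with $p(a_1,\dots,a_n)=0$ for all $a_1,\dots,a_n\in A$; (2) if $A$ satisfies a polynomial identity, then its Gelfand–Kirillov dimension $$\operatorname{GKdim}(A)=\sup_V\limsup_{n\to\infty}\frac{\log\dim_k(V^0+V^1+\cdots+V^n)}{\log n}$$ is at most $1$, where $V$ ranges over the finite-dimensional $k$-subspaces of $A$ and $V^0=k\cdot 1$. -/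

import Mathlib

/-- The monomial of the free algebra `k{x_i : i ∈ X}` attached to a word in the letters `X`
(the empty word gives `1`). -/
noncomputable def wordMonomial (k : Type*) [Field k] {X : Type*} (w : List X) :
    FreeAlgebra k X :=
  (w.map (FreeAlgebra.ι k)).prod

/-- The two-sided ideal of the free algebra generated by the monomials of the words in `S`. -/
noncomputable def monomialIdeal (k : Type*) [Field k] {X : Type*} (S : Set (List X)) :
    TwoSidedIdeal (FreeAlgebra k X) :=
  TwoSidedIdeal.span (wordMonomial k '' S)

/-- The monomial algebra `k{x_i : i ∈ X} / (S)`. -/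
abbrev MonomialQuotient (k : Type*) [Field k] {X : Type*} (S : Set (List X)) : Type _ :=
  (monomialIdeal k S).ringCon.Quotient

/-- `A` is a finitely presented monomial algebra: it is isomorphic, as a unital `k`-algebra, to a
free algebra on finitely many generators modulo the ideal generated by finitely many monomials. -/
def IsFinitelyPresentedMonomialAlgebra (k : Type*) [Field k] (A : Type*) [Ring A] [Algebra k A] :
    Prop :=
  ∃ (d : ℕ) (S : Set (List (Fin d))), S.Finite ∧ Nonempty (A ≃ₐ[k] MonomialQuotient k S)

/-- A (not necessarily commutative) ring is prime if it is nonzero and the product of two nonzero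
two-sided ideals is nonzero. -/
def IsPrimeNCRing (R : Type*) [Ring R] : Prop :=
  Nontrivial R ∧ ∀ I J : TwoSidedIdeal R, (∀ a ∈ I, ∀ b ∈ J, a * b = 0) → I = ⊥ ∨ J = ⊥

/-- A ring is left primitive if it has a faithful simple left module. (A simple module is a
quotient of the ring, so modules in the universe of the ring suffice.) -/
def IsLeftPrimitiveRing.{u} (R : Type u) [Ring R] : Prop :=
  ∃ (M : Type u) (_ : AddCommGroup M) (_ : Module R M), IsSimpleModule R M ∧ FaithfulSMul R M

/-- A ring is right primitive if it has a faithful simple right module; right modules are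
modules over the opposite ring. -/
def IsRightPrimitiveRing.{u} (R : Type u) [Ring R] : Prop :=
  ∃ (M : Type u) (_ : AddCommGroup M) (_ : Module Rᵐᵒᵖ M),
    IsSimpleModule Rᵐᵒᵖ M ∧ FaithfulSMul Rᵐᵒᵖ M

/-- A ring is primitive if it is both left and right primitive. -/
def IsPrimitiveNCRing (R : Type*) [Ring R] : Prop :=
  IsLeftPrimitiveRing R ∧ IsRightPrimitiveRing R

/-- `A` satisfies a polynomial identity: some nonzero noncommutative polynomial in finitely many
variables vanishes under all substitutions of elements of `A`. -/
def SatisfiesPolynomialIdentity (k : Type*) [Field k] (A : Type*) [Ring A] [Algebra k A] : Prop :=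
  ∃ (n : ℕ) (p : FreeAlgebra k (Fin n)), p ≠ 0 ∧ ∀ a : Fin n → A, FreeAlgebra.lift k a p = 0

/-- The Gelfand-Kirillov dimension of a `k`-algebra: the supremum, over the finite-dimensional
subspaces `V`, of `limsup log dim (V⁰ + V¹ + ⋯ + Vⁿ) / log n`, where `V⁰ = k`. -/
noncomputable def gelfandKirillovDim (k : Type*) [Field k] (A : Type*) [Ring A] [Algebra k A] :
    EReal :=
  ⨆ (V : Submodule k A) (_ : V.FG),
    Filter.limsup (fun n : ℕ =>
      ((Real.log (Module.finrank k (⨆ i : Fin (n + 1), V ^ (i : ℕ) : Submodule k A)) /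
        Real.log n : ℝ) : EReal)) Filter.atTop

/-! The words avoiding the relations form a basis of the algebra. Primeness says that any two of
them can be joined; finite presentation says that membership is local, so words glue along long
overlaps. Hence the basis words are the paths of a finite strongly connected graph whose vertices
are the words of length `L`. Either no vertex branches, or some vertex does.

If none branches, a path is determined by its starting vertex and its length. So growth is linear
and the GK dimension is at most one (`gelfandKirillovDim_le_one`). Sending each letter to its
transition matrix times a variable that records length loses no information, so the algebra inherits
a standard identity from matrices over `k[X]` (`satisfiesPolynomialIdentity`).

If the graph branches at `u`, two return words `a`, `b` with distinct first letters give the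
infinite prefix code `aⁿb` (`exists_prefixCode`). It generates a free subalgebra, which excludes
identities. It also leaves room to treat every nonzero element `f` separately: a return word `p v q`
is built around a monomial `v` of `f`, starting with a codeword reserved for `f`. The indicator
functional of the products of these words defines a proper left ideal comaximal with every nonzero
two-sided ideal; a maximal left ideal above it yields a faithful simple module
(`isLeftPrimitiveRing`). -/

/-- A language closed under factors, in which any two words can be joined, and in which membership
can be glued along overlaps of length at least `L`. -/
structure MarkovLanguage {X : Type*} (W : Set (List X)) (L : ℕ) : Prop where
  factor : ∀ p u q : List X, p ++ u ++ q ∈ W → u ∈ W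
  join : ∀ u ∈ W, ∀ v ∈ W, ∃ w, u ++ w ++ v ∈ W
  glue : ∀ p u q : List X, L ≤ u.length → p ++ u ∈ W → u ++ q ∈ W → p ++ u ++ q ∈ W
  exists_length : ∃ u ∈ W, u.length = L

/-- Every word of length at least `L` has at most one extension by a letter on the right. -/
def RightDeterministic {X : Type*} (W : Set (List X)) (L : ℕ) : Prop :=
  ∀ u ∈ W, L ≤ u.length → ∀ x y : X, u ++ [x] ∈ W → u ++ [y] ∈ W → x = y

/-- The words `w` that lead from `u` back to `u`. -/
def returnWords {X : Type*} (W : Set (List X)) (u : List X) : Set (List X) :=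
  {w | u ++ w ∈ W ∧ u <:+ u ++ w}

/-- The words of the language that avoids the factors in `S`. -/
def avoidingWords {X : Type*} (S : Set (List X)) : Set (List X) :=
  {w | ∀ s ∈ S, ¬ s <:+: w}

/-- The reversed language. -/
def reversedLanguage {X : Type*} (W : Set (List X)) : Set (List X) := {w | w.reverse ∈ W}

/-! ### Combinatorics of words: gluing, return words, prefix codes. -/

section Words

variable {X : Type*} {W : Set (List X)} {L : ℕ}

theorem avoidingWords_factor {S : Set (List X)} (p u q : List X)
    (h : p ++ u ++ q ∈ avoidingWords S) : u ∈ avoidingWords S :=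
  fun s hs hsu => h s hs (hsu.trans ⟨p, q, rfl⟩)

/-- A forbidden factor is no longer than `u`, so an occurrence cannot meet both `p` and `q`: it lies
in `p ++ u` or in `u ++ q`. -/
theorem avoidingWords_glue {S : Set (List X)} (hS : ∀ s ∈ S, s.length ≤ L) (p u q : List X)
    (hu : L ≤ u.length) (hp : p ++ u ∈ avoidingWords S) (hq : u ++ q ∈ avoidingWords S) :
    p ++ u ++ q ∈ avoidingWords S := by
  rintro s hs ⟨x, y, hxy⟩
  have hsL := hS s hs
  by_cases hle : (x ++ s).length ≤ (p ++ u).length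
  · have h1 : x ++ s <+: p ++ u :=
      List.prefix_of_prefix_length_le ⟨y, hxy⟩ ⟨q, rfl⟩ hle
    exact hp s hs ((List.suffix_append x s).isInfix.trans h1.isInfix)
  · have h1 : s ++ y <:+ u ++ q := by
      refine List.suffix_of_suffix_length_le (l₃ := p ++ u ++ q) ⟨x, by simpa using hxy⟩
        ⟨p, by simp⟩ ?_
      have := congrArg List.length hxy
      simp only [List.length_append] at this hle ⊢
      omega
    exact hq s hs ((List.prefix_append s y).isInfix.trans h1.isInfix)

/-- A language with the gluing property for some `L` has it for some `L` which is the length of a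
word of the language. -/
theorem exists_markovLanguage (hne : W.Nonempty)
    (hf : ∀ p u q : List X, p ++ u ++ q ∈ W → u ∈ W)
    (hj : ∀ u ∈ W, ∀ v ∈ W, ∃ w, u ++ w ++ v ∈ W)
    (hg : ∀ p u q : List X, L ≤ u.length → p ++ u ∈ W → u ++ q ∈ W → p ++ u ++ q ∈ W) :
    ∃ L, MarkovLanguage W L := by
  obtain ⟨v₀, hv₀⟩ := hne
  -- Repeated joining with a nonempty word gives arbitrarily long words, so the given `L` is
  -- attained by a factor. Otherwise only the empty word remains, and `0` works.
  by_cases h : ∃ u ∈ W, u ≠ []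
  · obtain ⟨u, hu, hu0⟩ := h
    have hlen : ∀ n : ℕ, ∃ v ∈ W, n ≤ v.length := by
      intro n
      induction n with
      | zero => exact ⟨u, hu, Nat.zero_le _⟩
      | succ n ih =>
        obtain ⟨v, hv, hn⟩ := ih
        obtain ⟨w, hw⟩ := hj v hv u hu
        refine ⟨_, hw, ?_⟩
        have := List.length_pos_iff.2 hu0
        simp only [List.length_append]
        omega
    obtain ⟨v, hv, hn⟩ := hlen L
    exact ⟨L, hf, hj, hg, v.take L, hf [] _ (v.drop L) (by simpa using hv), by simpa using hn⟩
  · have h' : ∀ u ∈ W, u = [] := fun u hu => by_contra fun h0 => h ⟨u, hu, h0⟩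
    refine ⟨0, hf, hj, fun p u q _ hp hq => ?_, v₀, hv₀, by simp [h' _ hv₀]⟩
    have h1 := h' _ hp
    have h2 := h' _ hq
    simp only [List.append_eq_nil_iff] at h1 h2
    simpa [h1.1, h2.1, h2.2] using hp

theorem MarkovLanguage.prefix_mem (h : MarkovLanguage W L) {u v : List X} (huv : u ++ v ∈ W) :
    u ∈ W := h.factor [] u v (by simpa using huv)

theorem MarkovLanguage.suffix_mem (h : MarkovLanguage W L) {u v : List X} (huv : u ++ v ∈ W) :
    v ∈ W := h.factor u v [] (by simpa using huv)

theorem MarkovLanguage.reversed (h : MarkovLanguage W L) :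
    MarkovLanguage (reversedLanguage W) L where
  factor p u q hw := h.factor q.reverse u.reverse p.reverse (by simpa [reversedLanguage] using hw)
  join u hu v hv := by
    obtain ⟨w, hw⟩ := h.join _ hv _ hu
    exact ⟨w.reverse, by simpa [reversedLanguage] using hw⟩
  glue p u q hu hp hq := by
    have := h.glue q.reverse u.reverse p.reverse (by simpa using hu)
      (by simpa [reversedLanguage] using hq) (by simpa [reversedLanguage] using hp)
    simpa [reversedLanguage] using this
  exists_length := by
    obtain ⟨u, hu, hL⟩ := h.exists_length
    exact ⟨u.reverse, by simpa [reversedLanguage] using hu, by simpa using hL⟩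

theorem MarkovLanguage.nil_mem_returnWords {u : List X} (hu : u ∈ W) : [] ∈ returnWords W u :=
  ⟨by simpa using hu, by simp⟩

theorem MarkovLanguage.append_mem_returnWords (h : MarkovLanguage W L) {u : List X}
    (hu : L ≤ u.length) {v w : List X} (hv : v ∈ returnWords W u) (hw : w ∈ returnWords W u) :
    v ++ w ∈ returnWords W u := by
  obtain ⟨hv, z, hz⟩ := hv
  obtain ⟨hw, y, hy⟩ := hw
  have h1 : u ++ (v ++ w) = z ++ u ++ w := by rw [hz, List.append_assoc]
  refine ⟨h1 ▸ h.glue z u w hu (hz ▸ hv) hw, z ++ y, ?_⟩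
  rw [h1, List.append_assoc, hy, List.append_assoc]

theorem MarkovLanguage.flatten_mem_returnWords (h : MarkovLanguage W L) {u : List X} (huW : u ∈ W)
    (hu : L ≤ u.length) {l : List (List X)} (hl : ∀ v ∈ l, v ∈ returnWords W u) :
    l.flatten ∈ returnWords W u := by
  induction l with
  | nil => exact MarkovLanguage.nil_mem_returnWords huW
  | cons v l ih =>
    rw [List.flatten_cons]
    exact h.append_mem_returnWords hu (hl v (by simp)) (ih fun w hw => hl w (by simp [hw]))

theorem RightDeterministic.eq_of_append (hd : RightDeterministic W L) (h : MarkovLanguage W L)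
    {p q s : List X} (hs : L ≤ s.length) (hp : s ++ p ∈ W) (hq : s ++ q ∈ W)
    (hpq : p.length = q.length) : p = q := by
  induction p generalizing q s with
  | nil => exact (List.length_eq_zero_iff.1 hpq.symm).symm
  | cons x p ih =>
    cases q with
    | nil => simp at hpq
    | cons y q =>
      have hp' : s ++ [x] ++ p ∈ W := by simpa using hp
      have hq' : s ++ [y] ++ q ∈ W := by simpa using hq
      obtain rfl := hd s (h.prefix_mem hp) hs x y (h.prefix_mem hp') (h.prefix_mem hq')
      rw [ih (by simp; omega) hp' hq' (by simpa using hpq)]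

/-- A branching language contains an infinite prefix code of return words. -/
theorem MarkovLanguage.exists_prefixCode (h : MarkovLanguage W L)
    (hd : ¬ RightDeterministic W L) :
    ∃ u ∈ W, L ≤ u.length ∧ ∃ c : ℕ → List X, (∀ n, c n ∈ returnWords W u) ∧
      ∀ i j, c i <+: c j → i = j := by
  unfold RightDeterministic at hd
  push Not at hd
  obtain ⟨u, hu, hL, x, y, hx, hy, hxy⟩ := hd
  obtain ⟨p, hp⟩ := h.join _ hx u hu
  obtain ⟨q, hq⟩ := h.join _ hy u hu
  have ha : x :: (p ++ u) ∈ returnWords W u :=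
    ⟨by simpa using hp, ⟨u ++ x :: p, by simp⟩⟩
  have hb : y :: (q ++ u) ∈ returnWords W u :=
    ⟨by simpa using hq, ⟨u ++ y :: q, by simp⟩⟩
  -- The code is `aⁿb`, where `a` starts with `x` and `b` with `y`: `aⁱb` and `aʲb` with `i ≠ j`
  -- differ at the first letter after their common power of `a`.
  refine ⟨u, hu, hL, fun n => (List.replicate n (x :: (p ++ u))).flatten ++ y :: (q ++ u),
    fun n => h.append_mem_returnWords hL
      (h.flatten_mem_returnWords hu hL fun v hv => by rwa [List.eq_of_mem_replicate hv]) hb, ?_⟩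
  intro i
  induction i with
  | zero =>
    intro j hj
    cases j with
    | zero => rfl
    | succ j =>
      simp only [List.replicate_succ, List.flatten_cons, List.replicate_zero, List.flatten_nil,
        List.nil_append, List.cons_append, List.cons_prefix_cons] at hj
      exact absurd hj.1.symm hxy
  | succ i ih =>
    intro j hj
    cases j with
    | zero =>
      simp only [List.replicate_succ, List.flatten_cons, List.replicate_zero, List.flatten_nil,
        List.nil_append, List.cons_append, List.cons_prefix_cons] at hj
      exact absurd hj.1 hxy
    | succ j =>
      rw [ih j]
      simpa only [List.replicate_succ, List.flatten_cons, List.append_assoc,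
        List.prefix_append_right_inj] using hj

/-- If reading backwards from `u` were deterministic, the words `u c₀ c₁` and `u c₁ c₀`, which have
equal length and both end in `u`, would coincide. Then `c₀` and `c₁` would be comparable. -/
theorem MarkovLanguage.not_rightDeterministic_reversed (h : MarkovLanguage W L)
    (hd : ¬ RightDeterministic W L) : ¬ RightDeterministic (reversedLanguage W) L := by
  intro hr
  obtain ⟨u, hu, hL, c, hc, hcode⟩ := h.exists_prefixCode hd
  obtain ⟨h1, z₁, hz₁⟩ := h.append_mem_returnWords hL (hc 0) (hc 1)
  obtain ⟨h2, z₂, hz₂⟩ := h.append_mem_returnWords hL (hc 1) (hc 0)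
  rw [← hz₁] at h1
  rw [← hz₂] at h2
  have hlen := congrArg List.length hz₁
  have hlen' := congrArg List.length hz₂
  simp only [List.length_append] at hlen hlen'
  have key : z₁.reverse = z₂.reverse :=
    hr.eq_of_append h.reversed (s := u.reverse) (by simpa using hL)
      (by simpa [reversedLanguage] using h1) (by simpa [reversedLanguage] using h2)
      (by simp only [List.length_reverse]; omega)
  rw [List.reverse_injective key, hz₂] at hz₁
  have h3 : c 1 ++ c 0 = c 0 ++ c 1 := List.append_cancel_left hz₁
  rcases List.prefix_or_prefix_of_prefix (l₃ := c 0 ++ c 1) ⟨c 0, h3⟩ ⟨c 1, rfl⟩ with h4 | h4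
  · exact absurd (hcode _ _ h4) one_ne_zero
  · exact absurd (hcode _ _ h4) zero_ne_one

/-- Two words one of which is a prefix of the other. -/
def PrefixComparable (u v : List X) : Prop := u <+: v ∨ v <+: u

theorem prefixComparable_append_left_iff {p u v : List X} :
    PrefixComparable (p ++ u) (p ++ v) ↔ PrefixComparable u v := by
  simp [PrefixComparable, List.prefix_append_right_inj]

theorem PrefixComparable.symm {u v : List X} (h : PrefixComparable u v) : PrefixComparable v u :=
  Or.symm h

theorem PrefixComparable.of_prefix {u v w z : List X} (h : PrefixComparable w z)
    (hu : u <+: w) (hv : v <+: z) : PrefixComparable u v := by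
  rcases h with h | h
  · exact List.prefix_or_prefix_of_prefix (hu.trans h) hv
  · exact List.prefix_or_prefix_of_prefix hu (hv.trans h)

theorem PrefixComparable.of_append_eq {u v s t : List X} (h : u ++ s = v ++ t) :
    PrefixComparable u v :=
  List.prefix_or_prefix_of_prefix ⟨s, h⟩ ⟨t, rfl⟩

theorem prefix_replicate_flatten {z q : List X} (hz : z ≠ []) (h : q <+: z ++ q) :
    ∀ n, q.length ≤ n → q <+: (List.replicate n z).flatten := by
  have hpos := List.length_pos_iff.2 hz
  have key : ∀ n, q <+: (List.replicate n z).flatten ++ q := by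
    intro n
    induction n with
    | zero => simp
    | succ n ih =>
      refine h.trans ?_
      rw [List.replicate_succ, List.flatten_cons, List.append_assoc,
        List.prefix_append_right_inj]
      exact ih
  intro n hn
  refine List.prefix_of_prefix_length_le (key n) (List.prefix_append _ _) ?_
  simp only [List.length_flatten, List.map_replicate, List.sum_replicate, smul_eq_mul]
  nlinarith

/-- A word `z ++ q` determines its prefix `q` up to comparability. -/
theorem PrefixComparable.of_prefix_append {z q q' : List X} (hz : z ≠ []) (h : q <+: z ++ q)
    (h' : q' <+: z ++ q') : PrefixComparable q q' :=
  List.prefix_or_prefix_of_prefix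
    (prefix_replicate_flatten hz h (max q.length q'.length) (le_max_left _ _))
    (prefix_replicate_flatten hz h' (max q.length q'.length) (le_max_right _ _))

/-- Comparability forces, up to symmetry, `w = v z` with `z` nonempty and `q` a prefix of `z q`. So
`q` is a prefix of the periodic word `zzz…`, and so is `q'`. -/
theorem PrefixComparable.of_append_append {v w q q' : List X} (hvw : v ≠ w)
    (h : PrefixComparable (v ++ q) (w ++ q)) (h' : PrefixComparable (v ++ q') (w ++ q')) :
    PrefixComparable q q' := by
  wlog hv : v <+: w generalizing v w
  · rcases h.of_prefix (List.prefix_append v q) (List.prefix_append w q) with h1 | h1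
    · exact absurd h1 hv
    · exact this hvw.symm h.symm h'.symm h1
  obtain ⟨z, rfl⟩ := hv
  have hz : z ≠ [] := by rintro rfl; simp at hvw
  have aux : ∀ q : List X, PrefixComparable (v ++ q) (v ++ z ++ q) → q <+: z ++ q := by
    intro q hq
    rw [List.append_assoc, prefixComparable_append_left_iff] at hq
    rcases hq with hq | hq
    · exact hq
    · have h1 := hq.length_le
      have := List.length_pos_iff.2 hz
      simp only [List.length_append] at h1
      omega
  exact PrefixComparable.of_prefix_append hz (aux q h) (aux q' h')

/-- Every word can be completed to a return word starting with a given codeword, in such a way that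
the same completion of finitely many other words gives incomparable words. -/
theorem MarkovLanguage.exists_completion (h : MarkovLanguage W L) {u : List X}
    (hL : L ≤ u.length) {c : ℕ → List X} (hc : ∀ n, c n ∈ returnWords W u)
    (hcode : ∀ i j, c i <+: c j → i = j) (n : ℕ) {v : List X} (hv : v ∈ W)
    (T : Finset (List X)) :
    ∃ p q : List X, c n <+: p ∧ p ++ v ++ q ∈ returnWords W u ∧
      ∀ w ∈ T, w ≠ v → ¬ PrefixComparable (p ++ v ++ q) (p ++ w ++ q) := by
  obtain ⟨r, hr⟩ := h.join _ (hc n).1 v hv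
  obtain ⟨r', hr'⟩ := h.join _ hr u (h.prefix_mem (hc 0).1)
  -- Each `w ≠ v` spoils at most one index `j`, because the `c j` are pairwise incomparable. All but
  -- finitely many endings `c j` are therefore admissible.
  have hfin : (⋃ w ∈ (T : Set (List X)) \ {v},
      {j | PrefixComparable (v ++ (r' ++ u ++ c j)) (w ++ (r' ++ u ++ c j))}).Finite := by
    refine Set.Finite.biUnion T.finite_toSet.sdiff fun w hw => Set.Subsingleton.finite ?_
    intro i hi j hj
    have h1 : PrefixComparable (r' ++ u ++ c i) (r' ++ u ++ c j) :=
      PrefixComparable.of_append_append (Ne.symm hw.2) hi hj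
    rw [prefixComparable_append_left_iff] at h1
    rcases h1 with h1 | h1
    · exact hcode _ _ h1
    · exact (hcode _ _ h1).symm
  obtain ⟨j, hj⟩ := hfin.exists_notMem
  refine ⟨c n ++ r, r' ++ u ++ c j, List.prefix_append _ _, ⟨?_, ?_⟩, fun w hw hwv hcomp => hj ?_⟩
  · have := h.glue _ u (c j) hL hr' (hc j).1
    simpa using this
  · obtain ⟨z, hz⟩ := (hc j).2
    refine ⟨u ++ c n ++ r ++ v ++ r' ++ z, ?_⟩
    simp only [List.append_assoc, hz]
  · rw [List.append_assoc, List.append_assoc (c n ++ r), prefixComparable_append_left_iff] at hcomp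
    exact Set.mem_iUnion₂.2 ⟨w, ⟨hw, hwv⟩, hcomp⟩

/-- The words obtained by concatenating words of `C`. -/
def concatenations (C : Set (List X)) : Set (List X) :=
  {s | ∃ l : List (List X), (∀ t ∈ l, t ∈ C) ∧ l.flatten = s}

theorem nil_mem_concatenations (C : Set (List X)) : [] ∈ concatenations C :=
  ⟨[], by simp, rfl⟩

/-- Unique decoding of a prefix code: the first codeword of a factorization is forced. -/
theorem append_mem_concatenations_iff {C : Set (List X)} (hne : [] ∉ C)
    (hC : ∀ s ∈ C, ∀ t ∈ C, PrefixComparable s t → s = t) {t s : List X} (ht : t ∈ C) :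
    t ++ s ∈ concatenations C ↔ s ∈ concatenations C := by
  constructor
  · rintro ⟨_ | ⟨t', l⟩, hl, hs⟩
    · have : t = [] := by
        rw [List.flatten_nil] at hs
        exact (List.append_eq_nil_iff.1 hs.symm).1
      exact absurd (this ▸ ht) hne
    · rw [List.flatten_cons] at hs
      obtain rfl := hC t' (hl t' (by simp)) t ht (PrefixComparable.of_append_eq hs)
      exact ⟨l, fun w hw => hl w (by simp [hw]), List.append_cancel_left hs⟩
  · rintro ⟨l, hl, rfl⟩
    exact ⟨t :: l, by simpa using ⟨ht, hl⟩, by simp⟩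

theorem append_notMem_concatenations {C : Set (List X)} {b s : List X} (hb : b ≠ [])
    (hC : ∀ t ∈ C, ¬ PrefixComparable b t) : b ++ s ∉ concatenations C := by
  rintro ⟨_ | ⟨t, l⟩, hl, hs⟩
  · rw [List.flatten_nil] at hs
    exact hb (List.append_eq_nil_iff.1 hs.symm).1
  · exact hC t (hl t (by simp)) (PrefixComparable.of_append_eq hs.symm)

theorem flatten_map_injective {ι : Type*} {c : ι → List X} (hne : ∀ i, c i ≠ [])
    (hcode : ∀ i j, c i <+: c j → i = j) :
    Function.Injective fun l : List ι => (l.map c).flatten := by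
  intro l
  induction l with
  | nil =>
    rintro (_ | ⟨j, m⟩) hm
    · rfl
    · simp [hne j] at hm
  | cons i l ih =>
    rintro (_ | ⟨j, m⟩) hm
    · simp [hne i] at hm
    · simp only [List.map_cons, List.flatten_cons] at hm
      have hij : i = j := by
        rcases PrefixComparable.of_append_eq hm with h1 | h1
        · exact hcode _ _ h1
        · exact (hcode _ _ h1).symm
      subst hij
      rw [ih (List.append_cancel_left hm)]

end Words

/-! ### Monomial bases and primitivity. -/

/-- The words of `W` form a basis of `R` through `μ`, and the other words are sent to zero. -/
structure IsMonomialBasis (k : Type*) [Field k] {R : Type*} [Ring R] [Algebra k R] {X : Type*}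
    (W : Set (List X)) (μ : List X → R) : Prop where
  eq_zero : ∀ w ∉ W, μ w = 0
  linearIndependent : LinearIndependent k fun w : W => μ w
  span_eq_top : Submodule.span k (Set.range μ) = ⊤

section Primitive

variable {k : Type*} [Field k] {R : Type*} [Ring R] [Algebra k R] {X : Type*}
  {W : Set (List X)} {μ : List X → R} {L : ℕ}

theorem IsMonomialBasis.span_subtype (h : IsMonomialBasis k W μ) :
    ⊤ ≤ Submodule.span k (Set.range fun w : W => μ w) := by
  rw [← h.span_eq_top, Submodule.span_le]
  rintro _ ⟨w, rfl⟩
  by_cases hw : w ∈ W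
  · exact Submodule.subset_span ⟨⟨w, hw⟩, rfl⟩
  · rw [h.eq_zero w hw]
    exact zero_mem _

theorem IsMonomialBasis.exists_eq_sum (h : IsMonomialBasis k W μ) (f : R) :
    ∃ (T : Finset (List X)) (α : List X → k), (∀ w ∈ T, w ∈ W ∧ α w ≠ 0) ∧
      f = ∑ w ∈ T, α w • μ w := by
  have hf : f ∈ Submodule.span k (μ '' W) := by
    have := h.span_subtype (Submodule.mem_top (x := f))
    rwa [Set.image_eq_range]
  obtain ⟨α, hα, rfl⟩ := (Finsupp.mem_span_image_iff_linearCombination k).1 hf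
  refine ⟨α.support, α, fun w hw => ⟨hα hw, Finsupp.mem_support_iff.1 hw⟩, ?_⟩
  rw [Finsupp.linearCombination_apply, Finsupp.sum]

open Classical in
theorem IsMonomialBasis.exists_indicator (h : IsMonomialBasis k W μ) {E : Set (List X)}
    (hE : E ⊆ W) : ∃ φ : R →ₗ[k] k, ∀ w, φ (μ w) = if w ∈ E then 1 else 0 := by
  let b := Module.Basis.mk h.linearIndependent h.span_subtype
  refine ⟨b.constr k fun w : W => if (w : List X) ∈ E then 1 else 0, fun w => ?_⟩
  by_cases hw : w ∈ W
  · have hb : μ w = b ⟨w, hw⟩ := by simp [b]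
    rw [hb, Module.Basis.constr_basis]
  · rw [h.eq_zero w hw, map_zero, if_neg fun hw' => hw (hE hw')]

/-- A ring is left primitive as soon as it has a proper left ideal that is comaximal with every
nonzero two-sided ideal. -/
theorem IsLeftPrimitiveRing.of_leftIdeal {R : Type*} [Ring R] (P : Submodule R R) (hP : P ≠ ⊤)
    (h : ∀ f : R, f ≠ 0 → ∃ p q e : R, IsUnit e ∧ q * f * p - e ∈ P) :
    IsLeftPrimitiveRing R := by
  obtain ⟨M, hM, hPM⟩ := (eq_top_or_exists_le_coatom P).resolve_left hP
  refine ⟨R ⧸ M, inferInstance, inferInstance, isSimpleModule_iff_isCoatom.2 hM, ⟨?_⟩⟩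
  intro f g hfg
  by_contra hne
  obtain ⟨p, q, e, ⟨e', rfl⟩, he⟩ := h (f - g) (sub_ne_zero.2 hne)
  have h1 : (f - g) * p ∈ M := by
    have := hfg (Submodule.Quotient.mk p)
    rw [← Submodule.Quotient.mk_smul, ← Submodule.Quotient.mk_smul, Submodule.Quotient.eq] at this
    simpa [sub_mul] using this
  have h2 : q * (f - g) * p ∈ M := by
    rw [mul_assoc]
    exact M.smul_mem q h1
  have h3 : (e' : R) ∈ M := by
    have := M.sub_mem h2 (hPM he)
    rwa [sub_sub_cancel] at this
  refine hM.1 (Ideal.eq_top_of_isUnit_mem M h3 e'.isUnit)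

/-- An algebra with a basis of monomials, multiplied in the opposite order, which form a branching
language is left primitive. -/
theorem MarkovLanguage.isLeftPrimitiveRing [Countable X] (hW : MarkovLanguage W L)
    (hd : ¬ RightDeterministic W L) (hμ : IsMonomialBasis k W μ)
    (hmul : ∀ v w, μ (v ++ w) = μ w * μ v) : IsLeftPrimitiveRing R := by
  classical
  obtain ⟨u, hu, hL, c, hc, hcode⟩ := hW.exists_prefixCode hd
  have hcne : ∀ n, c n ≠ [] := fun n hn =>
    absurd (hcode n (n + 1) (hn ▸ List.nil_prefix)) (by simp)
  -- `N` reserves a codeword for each pair of a distinguished monomial and a finite support.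
  -- Completions for different pairs are then incomparable.
  obtain ⟨N, hN⟩ := Countable.exists_injective_nat (W × Finset (List X))
  choose p q hp hpq hcomp using fun i : W × Finset (List X) =>
    hW.exists_completion hL hc hcode (N i) i.1.2 i.2
  have hpne : ∀ i w, p i ++ w ++ q i ≠ [] := by
    intro i w h0
    simp only [List.append_eq_nil_iff] at h0
    exact hcne _ (List.prefix_nil.1 (h0.1.1 ▸ hp i))
  have hidx : ∀ i j v w, PrefixComparable (p i ++ v ++ q i) (p j ++ w ++ q j) → i = j := by
    intro i j v w h
    have h1 : ∀ i w, c (N i) <+: p i ++ w ++ q i := fun i w =>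
      (hp i).trans (by rw [List.append_assoc]; exact List.prefix_append _ _)
    rcases h.of_prefix (h1 i v) (h1 j w) with h2 | h2
    · exact hN (hcode _ _ h2)
    · exact hN (hcode _ _ h2).symm
  set C : Set (List X) := Set.range fun i => p i ++ i.1 ++ q i with hCdef
  have hCne : [] ∉ C := by
    rintro ⟨i, hi⟩
    exact hpne i _ hi
  have hCcode : ∀ s ∈ C, ∀ t ∈ C, PrefixComparable s t → s = t := by
    rintro _ ⟨i, rfl⟩ _ ⟨j, rfl⟩ h
    rw [hidx i j _ _ h]
  have hEW : (u ++ ·) '' concatenations C ⊆ W := by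
    rintro _ ⟨_, ⟨l, hl, rfl⟩, rfl⟩
    refine (hW.flatten_mem_returnWords hu hL fun v hv => ?_).1
    obtain ⟨i, rfl⟩ := hl v hv
    exact hpq i
  obtain ⟨φ, hφ⟩ := hμ.exists_indicator hEW
  have hφu : ∀ s, φ (μ (u ++ s)) = if s ∈ concatenations C then 1 else 0 := by
    intro s
    rw [hφ]
    congr 1
    simp
  -- The largest left ideal on which `a ↦ φ (a * μ u)` vanishes.
  let P : Submodule R R :=
    { carrier := {a | ∀ b, φ (b * a * μ u) = 0}
      zero_mem' := by simp
      add_mem' := fun ha hb r => by simp [mul_add, add_mul, ha r, hb r]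
      smul_mem' := fun r a ha b => by simpa [mul_assoc] using ha (b * r) }
  have hmemP : ∀ a, (∀ s, φ (μ s * a * μ u) = 0) → a ∈ P := by
    intro a ha b
    have hb : b ∈ Submodule.span k (Set.range μ) := hμ.span_eq_top ▸ Submodule.mem_top
    induction hb using Submodule.span_induction with
    | mem x hx =>
      obtain ⟨s, rfl⟩ := hx
      exact ha s
    | zero => simp
    | add x y _ _ hx hy => simp [add_mul, hx, hy]
    | smul r x _ hx => simp [hx]
  refine IsLeftPrimitiveRing.of_leftIdeal P ?_ ?_
  · intro htop
    have h1 : (1 : R) ∈ P := htop ▸ Submodule.mem_top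
    have h2 := h1 1
    have h3 := hφu []
    rw [if_pos (nil_mem_concatenations C), List.append_nil] at h3
    rw [one_mul, one_mul, h3] at h2
    exact one_ne_zero h2
  · intro f hf
    obtain ⟨T, α, hT, rfl⟩ := hμ.exists_eq_sum f
    obtain ⟨v, hv⟩ : T.Nonempty := by
      rw [Finset.nonempty_iff_ne_empty]
      rintro rfl
      simp at hf
    obtain ⟨hvW, hαv⟩ := hT v hv
    set i : W × Finset (List X) := (⟨v, hvW⟩, T) with hi
    refine ⟨μ (p i), μ (q i), algebraMap k R (α v), (IsUnit.mk0 _ hαv).map _,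
      hmemP _ fun s => ?_⟩
    -- Since `μ` reverses products, the completion is read directly after `u`. For `w = v` it is a
    -- codeword and can be cancelled; for any other `w` in `T` it is comparable with no codeword,
    -- and `φ` vanishes.
    have hprod : ∀ w, μ s * (μ (q i) * μ w * μ (p i)) * μ u =
        μ (u ++ (p i ++ w ++ q i ++ s)) := by
      intro w
      simp only [hmul, mul_assoc]
    have hterm : ∀ w ∈ T, φ (μ s * (μ (q i) * μ w * μ (p i)) * μ u) =
        if w = v then φ (μ (u ++ s)) else 0 := by
      intro w hw
      rw [hprod, hφu]
      split_ifs with h1 h2 h2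
      · subst h2
        rw [hφu, if_pos ((append_mem_concatenations_iff hCne hCcode ⟨i, rfl⟩).1 h1)]
      · refine absurd h1 (append_notMem_concatenations (hpne i w) ?_)
        rintro _ ⟨j, rfl⟩ hj
        obtain rfl := hidx _ _ _ _ hj
        exact hcomp i w hw h2 hj.symm
      · subst h2
        rw [hφu, if_neg fun h3 => h1 ((append_mem_concatenations_iff hCne hCcode ⟨i, rfl⟩).2 h3)]
      · rfl
    have hexp : μ s * (μ (q i) * (∑ w ∈ T, α w • μ w) * μ (p i) - algebraMap k R (α v)) * μ u =
        (∑ w ∈ T, α w • (μ s * (μ (q i) * μ w * μ (p i)) * μ u)) - α v • μ (u ++ s) := by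
      rw [mul_sub, sub_mul, hmul u s, Algebra.algebraMap_eq_smul_one]
      simp only [Finset.mul_sum, Finset.sum_mul, mul_smul_comm, smul_mul_assoc, mul_one]
    rw [hexp, map_sub, map_sum, map_smul, Finset.sum_congr rfl fun w hw => by
      rw [map_smul, hterm w hw]]
    simp [hv]

end Primitive

/-! ### Standard identities and the monomial basis of the free algebra. -/

/-- The standard polynomial in `m` noncommuting variables, evaluated in an algebra. -/
noncomputable def standardAlternatingMap (R : Type*) [CommRing R] (B : Type*) [Ring B]
    [Algebra R B] (m : ℕ) : B [⋀^Fin m]→ₗ[R] B :=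
  MultilinearMap.alternatization (MultilinearMap.mkPiAlgebraFin R m B)

section StandardIdentity

theorem standardAlternatingMap_apply {R B : Type*} [CommRing R] [Ring B] [Algebra R B] {m : ℕ}
    (a : Fin m → B) : standardAlternatingMap R B m a =
      ∑ σ : Equiv.Perm (Fin m), Equiv.Perm.sign σ • (List.ofFn fun i => a (σ i)).prod := by
  rw [standardAlternatingMap, MultilinearMap.alternatization_apply]
  rfl

/-- The coefficients are signs, so the base rings need not agree. This allows passing from a
`k`-algebra to matrices, which have finite rank only over `k[X]`. -/
theorem map_standardAlternatingMap {R R' B B' : Type*} [CommRing R] [CommRing R'] [Ring B]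
    [Ring B'] [Algebra R B] [Algebra R' B'] (g : B →+* B') {m : ℕ} (a : Fin m → B) :
    g (standardAlternatingMap R B m a) = standardAlternatingMap R' B' m (fun i => g (a i)) := by
  simp only [standardAlternatingMap_apply, map_sum, Units.smul_def, map_zsmul, map_list_prod,
    List.map_ofFn]
  rfl

theorem standardAlternatingMap_eq_zero {R B ι : Type*} [CommRing R] [Ring B] [Algebra R B]
    [Fintype ι] (e : Module.Basis ι R B) {m : ℕ} (hm : Fintype.card ι < m) :
    standardAlternatingMap R B m = 0 := by
  -- An alternating map is determined by tuples of distinct basis vectors, and here there are too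
  -- few vectors for such a tuple.
  refine Module.Basis.ext_alternating e fun v hv => ?_
  have := Fintype.card_le_of_injective v hv
  rw [Fintype.card_fin] at this
  omega

variable (k : Type*) [Field k]

theorem wordMonomial_eq_basis {X : Type*} (w : List X) :
    wordMonomial k w = FreeAlgebra.basisFreeMonoid k X (FreeMonoid.ofList w) := by
  have h : FreeAlgebra.equivMonoidAlgebraFreeMonoid (wordMonomial k w) =
      MonoidAlgebra.of k (FreeMonoid X) (FreeMonoid.ofList w) := by
    induction w with
    | nil => simp [wordMonomial, MonoidAlgebra.one_def]
    | cons x w ih =>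
      rw [FreeMonoid.ofList_cons, map_mul, ← ih, wordMonomial, List.map_cons, List.prod_cons,
        map_mul]
      simp [FreeAlgebra.equivMonoidAlgebraFreeMonoid, wordMonomial]
  rw [← AlgEquiv.eq_symm_apply] at h
  rw [h]
  rfl

theorem isMonomialBasis_wordMonomial (X : Type*) :
    IsMonomialBasis k Set.univ (wordMonomial k : List X → FreeAlgebra k X) where
  eq_zero w hw := absurd (Set.mem_univ w) hw
  linearIndependent := by
    have h : (fun w : (Set.univ : Set (List X)) => wordMonomial k (w : List X)) =
        FreeAlgebra.basisFreeMonoid k X ∘ fun w => FreeMonoid.ofList w.1 :=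
      funext fun w => wordMonomial_eq_basis k _
    rw [h]
    exact (FreeAlgebra.basisFreeMonoid k X).linearIndependent.comp _
      (FreeMonoid.ofList.injective.comp Subtype.val_injective)
  span_eq_top := by
    rw [← (FreeAlgebra.basisFreeMonoid k X).span_eq]
    congr 1
    ext f
    constructor
    · rintro ⟨w, rfl⟩
      exact ⟨_, (wordMonomial_eq_basis k w).symm⟩
    · rintro ⟨w, rfl⟩
      exact ⟨w.toList, wordMonomial_eq_basis k _⟩

theorem lift_wordMonomial {X A : Type*} [Semiring A] [Algebra k A] (a : X → A) (w : List X) :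
    FreeAlgebra.lift k a (wordMonomial k w) = (w.map a).prod := by
  simp [wordMonomial, map_list_prod, Function.comp_def]

/-- Only the identity permutation contributes to the monomial `x₁⋯xₘ`, so its coefficient is `1`. -/
theorem standardAlternatingMap_freeAlgebra_ne_zero (m : ℕ) :
    standardAlternatingMap k (FreeAlgebra k (Fin m)) m (FreeAlgebra.ι k) ≠ 0 := by
  classical
  obtain ⟨φ, hφ⟩ := (isMonomialBasis_wordMonomial k (Fin m)).exists_indicator
    (Set.subset_univ {List.ofFn fun i : Fin m => i})
  intro h
  have h1 := congrArg φ h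
  have h2 : ∀ σ : Equiv.Perm (Fin m), (List.ofFn fun i => FreeAlgebra.ι k (σ i)).prod =
      wordMonomial k (List.ofFn σ) := by
    intro σ
    rw [wordMonomial, List.map_ofFn]
    rfl
  have h3 : ∀ σ : Equiv.Perm (Fin m), List.ofFn σ = List.ofFn (fun i : Fin m => i) ↔ σ = 1 := by
    intro σ
    rw [List.ofFn_injective.eq_iff]
    exact ⟨fun h => Equiv.ext fun i => congrFun h i, fun h => h ▸ rfl⟩
  simp only [standardAlternatingMap_apply, h2, Units.smul_def, map_sum, map_zsmul, hφ,
    Set.mem_singleton_iff, h3] at h1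
  simp at h1

end StandardIdentity

/-! ### Polynomial identities and growth. -/

section Growth

variable {k : Type*} [Field k] {A : Type*} [Ring A] [Algebra k A] {X : Type*}
  {W : Set (List X)} {μ : List X → A} {L : ℕ}

theorem map_letters_prod (hone : μ [] = 1) (hmul : ∀ v w, μ (v ++ w) = μ v * μ w)
    {ι : Type*} (c : ι → List X) (l : List ι) :
    (l.map fun i => μ (c i)).prod = μ (l.map c).flatten := by
  induction l with
  | nil => simp [hone]
  | cons i l ih => simp [hmul, ih]

theorem map_singletons_prod (hone : μ [] = 1) (hmul : ∀ v w, μ (v ++ w) = μ v * μ w)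
    (w : List X) : (w.map fun x => μ [x]).prod = μ w := by
  induction w with
  | nil => simp [hone]
  | cons x w ih => rw [List.map_cons, List.prod_cons, ih, ← hmul, List.singleton_append]

/-- An algebra with a basis of monomials forming a branching language satisfies no polynomial
identity. -/
theorem MarkovLanguage.not_satisfiesPolynomialIdentity (hW : MarkovLanguage W L)
    (hd : ¬ RightDeterministic W L) (hμ : IsMonomialBasis k W μ) (hone : μ [] = 1)
    (hmul : ∀ v w, μ (v ++ w) = μ v * μ w) : ¬ SatisfiesPolynomialIdentity k A := by
  rintro ⟨n, p, hp, hpz⟩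
  obtain ⟨u, hu, hL, c, hc, hcode⟩ := hW.exists_prefixCode hd
  have hcne : ∀ n, c n ≠ [] := fun n hn =>
    absurd (hcode n (n + 1) (hn ▸ List.nil_prefix)) (by simp)
  have hinj : Function.Injective fun l : List (Fin n) => (l.map fun i : Fin n => c i).flatten :=
    flatten_map_injective (fun i => hcne i) fun i j hij => Fin.ext (hcode _ _ hij)
  have hmem : ∀ l : List (Fin n), (l.map fun i : Fin n => c i).flatten ∈ W := fun l =>
    hW.suffix_mem (hW.flatten_mem_returnWords hu hL fun v hv => by
      obtain ⟨i, -, rfl⟩ := List.mem_map.1 hv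
      exact hc i).1
  have hind : LinearIndependent k fun l : List (Fin n) => μ (l.map fun i : Fin n => c i).flatten :=
    hμ.linearIndependent.comp (fun l : List (Fin n) => (⟨_, hmem l⟩ : W)) fun l m h =>
      hinj (congrArg Subtype.val h)
  obtain ⟨T, α, hT, rfl⟩ := (isMonomialBasis_wordMonomial k (Fin n)).exists_eq_sum p
  have h0 := hpz fun i : Fin n => μ (c i)
  simp only [map_sum, map_smul, lift_wordMonomial,
    map_letters_prod hone hmul fun i : Fin n => c i] at h0
  refine hp (Finset.sum_eq_zero fun w hw => ?_)
  exact absurd (linearIndependent_iff'.1 hind T α h0 w hw) (hT w hw).2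

theorem MarkovLanguage.exists_left_extension (hW : MarkovLanguage W L) {w : List X}
    (hw : w ∈ W) : ∃ u ∈ W, u.length = L ∧ u ++ w ∈ W := by
  obtain ⟨v, hv, hvL⟩ := hW.exists_length
  obtain ⟨r, hr⟩ := hW.join v hv w hw
  have h1 : (v ++ r).take r.length ++ ((v ++ r).drop r.length ++ w) ∈ W := by
    rwa [← List.append_assoc, List.take_append_drop]
  have h2 := hW.suffix_mem h1
  exact ⟨_, hW.prefix_mem h2, by simp [hvL], h2⟩

/-- The words of length `L` in a language. -/
abbrev WordState (W : Set (List X)) (L : ℕ) : Type _ := {u : List X // u ∈ W ∧ u.length = L}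

instance [Finite X] : Finite (WordState W L) :=
  Set.Finite.to_subtype ((List.finite_length_eq X L).subset fun _ hu => hu.2)

open Classical in
/-- The transition matrix of a letter between the words of length `L`. -/
noncomputable def transitionMatrix (k : Type*) [Field k] (W : Set (List X)) (L : ℕ) (x : X) :
    Matrix (WordState W L) (WordState W L) (Polynomial k) :=
  Matrix.of fun u v =>
    if u.1 ++ [x] ∈ W ∧ v.1 = (u.1 ++ [x]).drop 1 then Polynomial.X else 0

-- Reading `w` from `u` ends at the last `L` letters of `u w`. Gluing allows membership of `u w` to
-- be tested one letter at a time, remembering only the current state.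
open Classical in
theorem MarkovLanguage.transitionMatrix_prod (hW : MarkovLanguage W L)
    [Fintype (WordState W L)] [DecidableEq (WordState W L)] (w : List X) (u v : WordState W L) :
    (w.map (transitionMatrix k W L)).prod u v =
      if u.1 ++ w ∈ W ∧ v.1 = (u.1 ++ w).drop w.length then Polynomial.X ^ w.length else 0 := by
  induction w generalizing u with
  | nil =>
    simp [Matrix.one_apply, u.2.1, Subtype.ext_iff, eq_comm]
  | cons x w ih =>
    rw [List.map_cons, List.prod_cons, Matrix.mul_apply]
    simp only [ih]
    by_cases hx : u.1 ++ [x] ∈ W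
    · obtain ⟨t, v', hv'⟩ : ∃ t v', u.1 ++ [x] = t :: v' :=
        List.exists_cons_of_ne_nil (by simp)
      have hv'W : v' ∈ W := hW.suffix_mem (u := [t]) (by simpa [← hv'] using hx)
      have hv'L : v'.length = L := by
        have := congrArg List.length hv'
        simp only [List.length_append, List.length_cons, List.length_nil, u.2.2] at this
        omega
      have hword : u.1 ++ x :: w = t :: (v' ++ w) := by
        rw [← List.cons_append, ← hv']
        simp
      have hiff : u.1 ++ x :: w ∈ W ↔ v' ++ w ∈ W := by
        rw [hword]
        refine ⟨fun h => hW.suffix_mem (u := [t]) (by simpa using h), fun h => ?_⟩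
        have := hW.glue [t] v' w hv'L.ge (by simpa [← hv'] using hx) h
        simpa using this
      rw [Finset.sum_eq_single (⟨v', hv'W, hv'L⟩ : WordState W L)]
      · have h1 : transitionMatrix k W L x u ⟨v', hv'W, hv'L⟩ = Polynomial.X := by
          rw [transitionMatrix, Matrix.of_apply, if_pos ⟨hx, by simp [hv']⟩]
        rw [h1, hiff, hword]
        simp [pow_succ']
      · intro z _ hz
        rw [transitionMatrix, Matrix.of_apply, if_neg, zero_mul]
        rintro ⟨-, h⟩
        rw [hv'] at h
        exact hz (Subtype.ext (by simpa using h))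
      · simp
    · rw [if_neg, Finset.sum_eq_zero]
      · intro z _
        rw [transitionMatrix, Matrix.of_apply, if_neg fun h => hx h.1, zero_mul]
      · rintro ⟨h, -⟩
        exact hx (hW.prefix_mem (v := w) (by simpa using h))

/-- For a basis word `w` readable from `u`, the coefficient of `X ^ |w|` in the entry from `u` to
the end state of `u w` is the coefficient of `w` in `f`: by determinism no other word of that length
is readable from `u`. -/
theorem MarkovLanguage.lift_eq_zero_of_transitionMatrix (hW : MarkovLanguage W L)
    (hd : RightDeterministic W L) (hμ : IsMonomialBasis k W μ) (hone : μ [] = 1)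
    (hmul : ∀ v w, μ (v ++ w) = μ v * μ w) [Fintype (WordState W L)]
    [DecidableEq (WordState W L)] {f : FreeAlgebra k X}
    (hf : FreeAlgebra.lift k (transitionMatrix k W L) f = 0) :
    FreeAlgebra.lift k (fun x => μ [x]) f = 0 := by
  classical
  obtain ⟨T, α, hT, rfl⟩ := (isMonomialBasis_wordMonomial k X).exists_eq_sum f
  simp only [map_sum, map_smul, lift_wordMonomial] at hf ⊢
  refine Finset.sum_eq_zero fun w hw => ?_
  rw [map_singletons_prod hone hmul]
  by_cases hwW : w ∈ W
  · exfalso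
    obtain ⟨u, huW, huL, huw⟩ := hW.exists_left_extension hwW
    have hdrop : ∀ r : List X, u ++ r ∈ W →
        (u ++ r).drop r.length ∈ W ∧ ((u ++ r).drop r.length).length = L := fun r hr =>
      ⟨hW.suffix_mem (u := (u ++ r).take r.length) (by rwa [List.take_append_drop]),
        by simp [huL]⟩
    have hcoeff : ∀ r, ((r.map (transitionMatrix k W L)).prod ⟨u, huW, huL⟩
        ⟨_, hdrop w huw⟩).coeff w.length = if r = w then 1 else 0 := by
      intro r
      rw [hW.transitionMatrix_prod]
      split_ifs with h4 h5 h5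
      · rw [h5, Polynomial.coeff_X_pow_self]
      · rw [Polynomial.coeff_X_pow, if_neg]
        exact fun h6 => h5 (hd.eq_of_append hW huL.ge h4.1 huw h6.symm)
      · exact absurd ⟨h5 ▸ huw, by rw [h5]⟩ h4
      · simp
    have h1 := congrArg (fun M : Matrix (WordState W L) (WordState W L) (Polynomial k) =>
      (M ⟨u, huW, huL⟩ ⟨_, hdrop w huw⟩).coeff w.length) hf
    simp only [Matrix.sum_apply, Matrix.smul_apply, Polynomial.finsetSum_coeff,
      Polynomial.coeff_smul, hcoeff] at h1
    simp [hw, (hT w hw).2] at h1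
  · rw [hμ.eq_zero w hwW, smul_zero]

/-- An algebra with a basis of monomials forming a deterministic language satisfies a standard
identity. -/
theorem MarkovLanguage.satisfiesPolynomialIdentity [Finite X] (hW : MarkovLanguage W L)
    (hd : RightDeterministic W L) (hμ : IsMonomialBasis k W μ) (hone : μ [] = 1)
    (hmul : ∀ v w, μ (v ++ w) = μ v * μ w) : SatisfiesPolynomialIdentity k A := by
  classical
  have := Fintype.ofFinite (WordState W L)
  -- One more than the rank of the matrix algebra over `k[X]`.
  set m := Fintype.card (WordState W L × WordState W L) + 1 with hm
  refine ⟨m, _, standardAlternatingMap_freeAlgebra_ne_zero k m, fun a => ?_⟩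
  have hsurj : ∀ b : A, ∃ f : FreeAlgebra k X, FreeAlgebra.lift k (fun x => μ [x]) f = b := by
    intro b
    obtain ⟨T, α, -, rfl⟩ := hμ.exists_eq_sum b
    refine ⟨∑ w ∈ T, α w • wordMonomial k w, ?_⟩
    simp only [map_sum, map_smul, lift_wordMonomial]
    refine Finset.sum_congr rfl fun w _ => ?_
    rw [map_singletons_prod hone hmul]
  choose F hF using fun i => hsurj (a i)
  have h1 : FreeAlgebra.lift k a
      (standardAlternatingMap k (FreeAlgebra k (Fin m)) m (FreeAlgebra.ι k)) =
      FreeAlgebra.lift k (fun x => μ [x]) (standardAlternatingMap k (FreeAlgebra k X) m F) := by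
    have h2 := map_standardAlternatingMap (R := k) (R' := k) (FreeAlgebra.lift k a).toRingHom
      (FreeAlgebra.ι k)
    have h3 := map_standardAlternatingMap (R := k) (R' := k)
      (FreeAlgebra.lift k (fun x => μ [x])).toRingHom F
    refine h2.trans (Eq.trans ?_ h3.symm)
    congr 1
    funext i
    simp [hF]
  rw [h1]
  refine hW.lift_eq_zero_of_transitionMatrix hd hμ hone hmul ?_
  have h2 := map_standardAlternatingMap (R := k) (R' := Polynomial k)
    (FreeAlgebra.lift k (transitionMatrix k W L)).toRingHom F
  refine h2.trans ?_
  rw [standardAlternatingMap_eq_zero (Matrix.stdBasis (Polynomial k) (WordState W L)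
    (WordState W L)) (Nat.lt_succ_self _)]
  rfl

/-- An algebra with a filtration of linear growth has Gelfand-Kirillov dimension at most one. -/
theorem gelfandKirillovDim_le_one_of_filtration (F : ℕ → Submodule k A) (hF : Monotone F)
    (hF1 : 1 ≤ F 0) (hFmul : ∀ a b, F a * F b ≤ F (a + b)) (hFtop : ∀ a, ∃ r, a ∈ F r) (C : ℕ)
    (hfin : ∀ m, Module.Finite k (F m)) (hC : ∀ m, Module.finrank k (F m) ≤ C * (m + 1)) :
    gelfandKirillovDim k A ≤ 1 := by
  refine iSup₂_le fun V hV => ?_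
  obtain ⟨s, rfl⟩ := hV
  choose ρ hρ using hFtop
  set r := s.sup ρ with hr
  have hVr : Submodule.span k (s : Set A) ≤ F r :=
    Submodule.span_le.2 fun a ha => hF (Finset.le_sup ha) (hρ a)
  set V := Submodule.span k (s : Set A) with hVdef
  have hpow : ∀ i, V ^ i ≤ F (r * i) := by
    intro i
    induction i with
    | zero => simpa using hF1
    | succ i ih =>
      rw [pow_succ, mul_add, mul_one]
      exact (mul_le_mul' ih hVr).trans (hFmul _ _)
  have hrank : ∀ n : ℕ, 1 ≤ n →
      Module.finrank k (⨆ i : Fin (n + 1), V ^ (i : ℕ) : Submodule k A) ≤ (C * (r + 1) + 1) * n := by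
    intro n hn
    have h1 : (⨆ i : Fin (n + 1), V ^ (i : ℕ) : Submodule k A) ≤ F (r * n) :=
      iSup_le fun i => (hpow i).trans (hF (Nat.mul_le_mul_left r (by omega)))
    have := hfin (r * n)
    refine (Submodule.finrank_mono h1).trans ((hC _).trans ?_)
    calc C * (r * n + 1) ≤ C * (r * n + n) := by gcongr
      _ ≤ (C * (r + 1) + 1) * n := by ring_nf; omega
  -- Dimensions are at most `D * n`, so the quotient of logarithms is at most `log D / log n + 1`,
  -- which tends to `1`.
  set D : ℝ := ((C * (r + 1) + 1 : ℕ) : ℝ) with hD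
  have hD1 : 1 ≤ D := by rw [hD]; exact_mod_cast Nat.le_add_left _ _
  have hlim : Filter.Tendsto (fun n : ℕ => ((Real.log D / Real.log n + 1 : ℝ) : EReal))
      Filter.atTop (nhds ((1 : ℝ) : EReal)) := by
    refine (continuous_coe_real_ereal.tendsto _).comp ?_
    have h1 : Filter.Tendsto (fun n : ℕ => Real.log (n : ℝ)) Filter.atTop Filter.atTop :=
      Real.tendsto_log_atTop.comp tendsto_natCast_atTop_atTop
    simpa using (h1.const_div_atTop (Real.log D)).add_const 1
  refine le_trans (Filter.limsup_le_limsup ?_) hlim.limsup_eq.le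
  filter_upwards [Filter.eventually_ge_atTop 2] with n hn
  rw [EReal.coe_le_coe_iff]
  have hn1 : (1 : ℝ) < n := by exact_mod_cast hn
  have hlog : 0 < Real.log n := Real.log_pos hn1
  rw [div_add_one hlog.ne']
  refine div_le_div_of_nonneg_right ?_ hlog.le
  rw [← Real.log_mul (by positivity) (by positivity)]
  -- In dimension zero `Real.log 0 = 0`; the bound persists because the extra summand in `D` gives
  -- `1 ≤ D`.
  rcases Nat.eq_zero_or_pos
    (Module.finrank k (⨆ i : Fin (n + 1), V ^ (i : ℕ) : Submodule k A)) with h0 | h0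
  · rw [h0, Nat.cast_zero, Real.log_zero]
    exact Real.log_nonneg (by nlinarith)
  · refine Real.log_le_log (by exact_mod_cast h0) ?_
    rw [hD]
    exact_mod_cast hrank n (by omega)

/-- The span of the monomials of length at most `m`. -/
def lengthFiltration (k : Type*) [Field k] {A : Type*} [Ring A] [Algebra k A] (W : Set (List X))
    (μ : List X → A) (m : ℕ) : Submodule k A :=
  Submodule.span k (μ '' {w | w ∈ W ∧ w.length ≤ m})

/-- An algebra with a basis of monomials forming a deterministic language has Gelfand-Kirillov
dimension at most one. -/
theorem MarkovLanguage.gelfandKirillovDim_le_one [Finite X] (hW : MarkovLanguage W L)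
    (hd : RightDeterministic W L) (hμ : IsMonomialBasis k W μ) (hone : μ [] = 1)
    (hmul : ∀ v w, μ (v ++ w) = μ v * μ w) : gelfandKirillovDim k A ≤ 1 := by
  classical
  have := Fintype.ofFinite (WordState W L)
  -- A word is recovered from its length and a state placed to its left.
  have hcount : ∀ m, ∃ g : {w | w ∈ W ∧ w.length ≤ m} → WordState W L × Fin (m + 1),
      Function.Injective g := by
    intro m
    choose e he heL hew using fun w : {w | w ∈ W ∧ w.length ≤ m} =>
      hW.exists_left_extension w.2.1
    refine ⟨fun w => (⟨e w, he w, heL w⟩, ⟨w.1.length, Nat.lt_succ_of_le w.2.2⟩), ?_⟩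
    intro v w hvw
    simp only [Prod.mk.injEq, Subtype.mk.injEq, Fin.mk.injEq] at hvw
    exact Subtype.ext (hd.eq_of_append hW (heL w).ge (hvw.1 ▸ hew v) (hew w) hvw.2)
  refine gelfandKirillovDim_le_one_of_filtration (lengthFiltration k W μ) ?_ ?_ ?_ ?_
    (Fintype.card (WordState W L)) ?_ ?_
  · exact fun a b hab => Submodule.span_mono (Set.image_mono fun w hw => ⟨hw.1, hw.2.trans hab⟩)
  · obtain ⟨u, hu, -⟩ := hW.exists_length
    rw [Submodule.one_le, ← hone]
    exact Submodule.subset_span ⟨[], ⟨hW.prefix_mem (u := []) hu, le_rfl⟩, rfl⟩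
  · intro a b
    rw [lengthFiltration, lengthFiltration, Submodule.span_mul_span, Submodule.span_le]
    rintro _ ⟨_, ⟨v, hv, rfl⟩, _, ⟨w, hw, rfl⟩, rfl⟩
    show μ v * μ w ∈ _
    rw [← hmul]
    by_cases hvw : v ++ w ∈ W
    · refine Submodule.subset_span ⟨_, ⟨hvw, ?_⟩, rfl⟩
      rw [List.length_append]
      exact add_le_add hv.2 hw.2
    · rw [hμ.eq_zero _ hvw]
      exact zero_mem _
  · intro a
    obtain ⟨T, α, hT, rfl⟩ := hμ.exists_eq_sum a
    exact ⟨T.sup List.length, Submodule.sum_mem _ fun w hw => Submodule.smul_mem _ _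
      (Submodule.subset_span ⟨w, ⟨(hT w hw).1, Finset.le_sup (f := List.length) hw⟩, rfl⟩)⟩
  · intro m
    obtain ⟨g, hg⟩ := hcount m
    have : Finite {w | w ∈ W ∧ w.length ≤ m} := Finite.of_injective g hg
    exact Module.Finite.span_of_finite k (Set.toFinite _)
  · intro m
    obtain ⟨g, hg⟩ := hcount m
    have := Fintype.ofInjective g hg
    rw [lengthFiltration, Set.image_eq_range]
    refine (finrank_range_le_card _).trans ((Fintype.card_le_of_injective g hg).trans ?_)
    rw [Fintype.card_prod, Fintype.card_fin]

end Growth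

/-! ### Monomial bases of prime finitely presented monomial algebras. -/

section MonomialAlgebra

theorem IsMonomialBasis.reversed {k : Type*} [Field k] {R : Type*} [Ring R] [Algebra k R]
    {X : Type*} {W : Set (List X)} {μ : List X → R} (h : IsMonomialBasis k W μ) :
    IsMonomialBasis k (reversedLanguage W) fun w => μ w.reverse where
  eq_zero w hw := h.eq_zero _ hw
  linearIndependent := h.linearIndependent.comp
    (fun w : reversedLanguage W => (⟨_, w.2⟩ : W)) fun v w hvw =>
      Subtype.ext (List.reverse_injective (congrArg Subtype.val hvw))
  span_eq_top := by
    rw [← h.span_eq_top]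
    congr 1
    exact List.reverse_involutive.surjective.range_comp μ

theorem IsMonomialBasis.op {k : Type*} [Field k] {R : Type*} [Ring R] [Algebra k R]
    {X : Type*} {W : Set (List X)} {μ : List X → R} (h : IsMonomialBasis k W μ) :
    IsMonomialBasis k W fun w => MulOpposite.op (μ w) where
  eq_zero w hw := by rw [h.eq_zero w hw, MulOpposite.op_zero]
  linearIndependent := h.linearIndependent.map' (MulOpposite.opLinearEquiv k).toLinearMap
    (LinearEquiv.ker _)
  span_eq_top := by
    have := congrArg (Submodule.map (MulOpposite.opLinearEquiv k (M := R)).toLinearMap)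
      h.span_eq_top
    rw [Submodule.map_span, ← Set.range_comp, Submodule.map_top, LinearEquiv.range] at this
    exact this

/-- In a prime ring, any two nonzero elements have a nonzero product with a third one between. -/
theorem IsPrimeNCRing.exists_mul_mul_ne_zero {R : Type*} [Ring R] (h : IsPrimeNCRing R) {a b : R}
    (ha : a ≠ 0) (hb : b ≠ 0) : ∃ r, a * r * b ≠ 0 := by
  by_contra! hab
  -- If `aRb = 0`, then `I = {x | xRb = 0}` contains `a`, its annihilator `J = {y | IRy = 0}`
  -- contains `b`, and `IJ = 0`.
  let I : TwoSidedIdeal R := .mk' {x | ∀ r, x * r * b = 0} (by simp)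
    (fun hx hy r => by simp [add_mul, hx r, hy r]) (fun hx r => by simp [hx r])
    (fun {x y} hy r => by simp [mul_assoc x, hy r])
    (fun {x y} hx r => by simpa [mul_assoc] using hx (y * r))
  have hI : ∀ x, x ∈ I ↔ ∀ r, x * r * b = 0 := fun x => TwoSidedIdeal.mem_mk' _ _ _ _ _ _ x
  let J : TwoSidedIdeal R := .mk' {y | ∀ x ∈ I, ∀ r, x * r * y = 0} (by simp)
    (fun hx hy z hz r => by simp [mul_add, hx z hz r, hy z hz r])
    (fun hx z hz r => by simp [hx z hz r])
    (fun {x y} hy z hz r => by simpa [mul_assoc] using hy z hz (r * x))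
    (fun {x y} hx z hz r => by rw [← mul_assoc, hx z hz r, zero_mul])
  have hJ : ∀ y, y ∈ J ↔ ∀ x ∈ I, ∀ r, x * r * y = 0 :=
    fun x => TwoSidedIdeal.mem_mk' _ _ _ _ _ _ x
  rcases h.2 I J fun x hx y hy => by simpa using (hJ y).1 hy x hx 1 with h0 | h0
  · refine ha ?_
    have : a ∈ I := (hI a).2 hab
    rwa [h0, TwoSidedIdeal.mem_bot] at this
  · refine hb ?_
    have : b ∈ J := (hJ b).2 fun x hx => (hI x).1 hx
    rwa [h0, TwoSidedIdeal.mem_bot] at this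

/-- If no word joined `u` to `v`, then `μ u * R * μ v = 0`, contrary to primeness. -/
theorem IsMonomialBasis.exists_join {k : Type*} [Field k] {R : Type*} [Ring R] [Algebra k R]
    {X : Type*} {W : Set (List X)} {μ : List X → R} (h : IsMonomialBasis k W μ)
    (hmul : ∀ v w, μ (v ++ w) = μ v * μ w) (hR : IsPrimeNCRing R) (u : List X) (hu : u ∈ W)
    (v : List X) (hv : v ∈ W) : ∃ w, u ++ w ++ v ∈ W := by
  by_contra! huv
  obtain ⟨r, hr⟩ := hR.exists_mul_mul_ne_zero (h.linearIndependent.ne_zero ⟨u, hu⟩)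
    (h.linearIndependent.ne_zero ⟨v, hv⟩)
  refine hr ?_
  obtain ⟨T, α, -, rfl⟩ := h.exists_eq_sum r
  rw [Finset.mul_sum, Finset.sum_mul]
  refine Finset.sum_eq_zero fun w _ => ?_
  rw [mul_smul_comm, smul_mul_assoc, ← hmul, ← hmul, h.eq_zero _ (huv w), smul_zero]

variable (k : Type*) [Field k] {X : Type*}

open Classical in
/-- The operator that puts a letter in front of a word, if this gives a word avoiding `S`. -/
noncomputable def prependLetter (S : Set (List X)) (x : X) : Module.End k (List X →₀ k) :=
  Finsupp.linearCombination k fun w =>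
    if x :: w ∈ avoidingWords S then Finsupp.single (x :: w) 1 else 0

open Classical in
theorem prependLetter_prod {S : Set (List X)} (w v : List X) (hv : v ∈ avoidingWords S) :
    (w.map (prependLetter k S)).prod (Finsupp.single v 1) =
      if w ++ v ∈ avoidingWords S then Finsupp.single (w ++ v) 1 else 0 := by
  induction w with
  | nil => simp [hv]
  | cons x w ih =>
    rw [List.map_cons, List.prod_cons, Module.End.mul_apply, ih]
    by_cases hw : w ++ v ∈ avoidingWords S
    · simp [hw, prependLetter]
    · rw [if_neg hw, map_zero, if_neg]
      exact fun h => hw (avoidingWords_factor [x] _ [] (by simpa using h))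

/-- On an avoiding word, prepending `s` creates a forbidden factor. On any other word the last
letter of `s` already gives zero, which needs `s` nonempty. -/
theorem prependLetter_prod_eq_zero {S : Set (List X)} (hS : [] ∉ S) {s : List X} (hs : s ∈ S) :
    (s.map (prependLetter k S)).prod = 0 := by
  classical
  refine Finsupp.lhom_ext' fun v => LinearMap.ext_ring ?_
  rw [LinearMap.comp_apply, Finsupp.lsingle_apply]
  by_cases hv : v ∈ avoidingWords S
  · rw [prependLetter_prod k _ _ hv, if_neg]
    · rfl
    · exact fun h => h _ hs (List.prefix_append _ _).isInfix
  · obtain ⟨t, x, rfl⟩ :=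
      (List.eq_nil_or_concat' s).resolve_left (ne_of_mem_of_not_mem hs hS)
    have hx : x :: v ∉ avoidingWords S := fun h =>
      hv (avoidingWords_factor [x] v [] (by simpa using h))
    have h0 : prependLetter k S x (Finsupp.single v 1) = 0 := by simp [prependLetter, hx]
    rw [List.map_append, List.prod_append, Module.End.mul_apply, List.map_singleton,
      List.prod_singleton, h0, map_zero]
    rfl

theorem wordMonomial_append (v w : List X) :
    wordMonomial k (v ++ w) = wordMonomial k v * wordMonomial k w := by
  simp [wordMonomial]

theorem lift_prependLetter_eq_zero {S : Set (List X)} (hS : [] ∉ S) {f : FreeAlgebra k X}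
    (hf : f ∈ monomialIdeal k S) : FreeAlgebra.lift k (prependLetter k S) f = 0 := by
  have h : monomialIdeal k S ≤ TwoSidedIdeal.ker (FreeAlgebra.lift k (prependLetter k S)) := by
    rw [monomialIdeal, TwoSidedIdeal.span_le]
    rintro _ ⟨s, hs, rfl⟩
    rw [SetLike.mem_coe, TwoSidedIdeal.mem_ker, lift_wordMonomial,
      prependLetter_prod_eq_zero k hS hs]
  exact (TwoSidedIdeal.mem_ker _).1 (h hf)

theorem wordMonomial_mem_monomialIdeal {S : Set (List X)} {w : List X}
    (hw : w ∉ avoidingWords S) : wordMonomial k w ∈ monomialIdeal k S := by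
  simp only [avoidingWords, Set.mem_ofPred_eq, not_forall, not_not] at hw
  obtain ⟨s, hs, x, y, rfl⟩ := hw
  rw [wordMonomial_append, wordMonomial_append]
  exact TwoSidedIdeal.mul_mem_right _ _ _ (TwoSidedIdeal.mul_mem_left _ _ _
    (TwoSidedIdeal.subset_span ⟨s, hs, rfl⟩))

/-- The words avoiding `S` form a basis of a quotient of the free algebra by the ideal generated by
the monomials in `S`. -/
theorem isMonomialBasis_avoidingWords {A : Type*} [Ring A] [Algebra k A] {S : Set (List X)}
    (hS : [] ∉ S) (π : FreeAlgebra k X →ₐ[k] A) (hπ : Function.Surjective π)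
    (hker : ∀ f, π f = 0 ↔ f ∈ monomialIdeal k S) :
    IsMonomialBasis k (avoidingWords S) fun w => π (wordMonomial k w) where
  eq_zero w hw := (hker _).2 (wordMonomial_mem_monomialIdeal k hw)
  linearIndependent := by
    classical
    rw [linearIndependent_iff']
    intro T α hα i hi
    have h1 : π (∑ w ∈ T, α w • wordMonomial k (w : List X)) = 0 := by
      simpa only [map_sum, map_smul] using hα
    have h2 := lift_prependLetter_eq_zero k hS ((hker _).1 h1)
    have hnil : [] ∈ avoidingWords S := avoidingWords_factor [] [] i (by simp)
    -- Acting on the empty word, the monomial of an avoiding word `w` gives the basis vector `w`;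
    -- the coordinate at `i` is thus `α i`.
    have h3 := congrArg (fun φ : Module.End k (List X →₀ k) => φ (Finsupp.single [] 1) i) h2
    simp only [map_sum, map_smul, lift_wordMonomial, LinearMap.sum_apply, LinearMap.smul_apply,
      prependLetter_prod k _ _ hnil, List.append_nil, Subtype.coe_prop, if_true,
      Finsupp.finsetSum_apply, Finsupp.smul_apply, Finsupp.single_apply, smul_eq_mul,
      LinearMap.zero_apply, Finsupp.zero_apply] at h3
    simpa [← Subtype.ext_iff, hi] using h3
  span_eq_top := by
    have h := congrArg (Submodule.map π.toLinearMap) (isMonomialBasis_wordMonomial k X).span_eq_top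
    rw [Submodule.map_span, ← Set.range_comp, Submodule.map_top,
      LinearMap.range_eq_top.2 (show Function.Surjective π.toLinearMap from hπ)] at h
    exact h

/-- A prime finitely presented monomial algebra has a basis of monomials that form a language with
the gluing property. -/
theorem IsFinitelyPresentedMonomialAlgebra.exists_isMonomialBasis {A : Type*} [Ring A]
    [Algebra k A] (hA : IsFinitelyPresentedMonomialAlgebra k A) (hprime : IsPrimeNCRing A) :
    ∃ (d L : ℕ) (W : Set (List (Fin d))) (μ : List (Fin d) → A), MarkovLanguage W L ∧
      IsMonomialBasis k W μ ∧ μ [] = 1 ∧ ∀ v w, μ (v ++ w) = μ v * μ w := by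
  obtain ⟨d, S, hSfin, ⟨e⟩⟩ := hA
  have := hprime.1
  let π : FreeAlgebra k (Fin d) →ₐ[k] A :=
    e.symm.toAlgHom.comp ((monomialIdeal k S).ringCon.mkₐ (α := k))
  have hπ : Function.Surjective π :=
    e.symm.surjective.comp (RingCon.mkₐ_surjective (α := k) _)
  have hker : ∀ f, π f = 0 ↔ f ∈ monomialIdeal k S := by
    intro f
    rw [TwoSidedIdeal.mem_iff, ← RingCon.eq]
    exact EmbeddingLike.map_eq_zero_iff (f := e.symm)
  have hμ1 : π (wordMonomial k []) = 1 := by simp [wordMonomial]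
  have hS : [] ∉ S := by
    intro h
    have h1 := (hker _).2 (TwoSidedIdeal.subset_span ⟨[], h, rfl⟩)
    rw [hμ1] at h1
    exact one_ne_zero h1
  have hbasis := isMonomialBasis_avoidingWords k hS π hπ hker
  have hmul : ∀ v w, π (wordMonomial k (v ++ w)) =
      π (wordMonomial k v) * π (wordMonomial k w) := fun v w => by
    rw [wordMonomial_append, map_mul]
  obtain ⟨N, hN⟩ := (hSfin.image List.length).bddAbove
  obtain ⟨L, hL⟩ := exists_markovLanguage (W := avoidingWords S) (L := N)
    ⟨[], fun s hs h => hS (List.infix_nil.1 h ▸ hs)⟩ avoidingWords_factor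
    (hbasis.exists_join hmul hprime)
    (avoidingWords_glue fun s hs => hN (Set.mem_image_of_mem _ hs))
  exact ⟨d, L, avoidingWords S, _, hL, hbasis, hμ1, hmul⟩

end MonomialAlgebra

theorem theorem1p2 (k : Type*) [Field k] (A : Type*) [Ring A] [Algebra k A]
    (hA : IsFinitelyPresentedMonomialAlgebra k A) (hprime : IsPrimeNCRing A) :
    (IsPrimitiveNCRing A ∨ SatisfiesPolynomialIdentity k A) ∧
      (SatisfiesPolynomialIdentity k A → gelfandKirillovDim k A ≤ 1) := by
  obtain ⟨d, L, W, μ, hW, hμ, hone, hmul⟩ := hA.exists_isMonomialBasis k hprime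
  by_cases hd : RightDeterministic W L
  · exact ⟨Or.inr (hW.satisfiesPolynomialIdentity hd hμ hone hmul),
      fun _ => hW.gelfandKirillovDim_le_one hd hμ hone hmul⟩
  · refine ⟨Or.inl ⟨?_, ?_⟩, fun h =>
      absurd h (hW.not_satisfiesPolynomialIdentity hd hμ hone hmul)⟩
    -- The criterion wants `μ` to reverse products. Reversing words achieves this for `A` itself,
    -- and passing to `Aᵐᵒᵖ` achieves it for right modules.
    · exact hW.reversed.isLeftPrimitiveRing (hW.not_rightDeterministic_reversed hd) hμ.reversed
        fun v w => by rw [List.reverse_append, hmul]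
    · exact hW.isLeftPrimitiveRing hd hμ.op fun v w => by rw [hmul, MulOpposite.op_mul]
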